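/- Let $\mathfrak{D}_n$ be the set of derangements (permutations without fixed points) of $[n]=\{1,\dots,n\}$. For $\pi=\pi_1\cdots\pi_n\in\mathfrak{D}_n$ let $\mathrm{cpk}(\pi)$, $\mathrm{cval}(\pi)$, $\mathrm{cdasc}(\pi)$ and $\mathrm{cddes}(\pi)$ be the numbers of letters $\pi_i$, $i\in[n]$, such that $i<\pi_i>\pi_{\pi_i}$ (cyclic peaks), $i>\pi_i<\pi_{\pi_i}$ (cyclic valleys), $i<\pi_i<\pi_{\pi_i}$ (cyclic double ascents) and $i>\pi_i>\pi_{\pi_i}$ (cyclic double descents), respectively. Define $U_n(s,t)$ by $U_0(s,t)=1$, $U_1(s,t)=2t$ and $U_n(s,t)=2t\,U_{n-1}(s,t)-s\,U_{n-2}(s,t)$ for $n\ge 2$, and let $V(s,t;x)=\sum_{n\ge 0}U_n(s,t)\frac{x^{n+2}}{(n+2)!}$, a formal power series in $x$. Let $s,t,u,v$ be indeterminates, or more generally any elements of a commutative $\mathbb{Q}$-algebra $R$. Then $1-st\,V\!\left(st,\tfrac{u+v}{2};x\right)$ is invertible in the ring $R[[x]]$ of formal power series, and $$1+\sum_{n\ge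 1}\Bigl(\sum_{\pi\in\mathfrak{D}_n}s^{\mathrm{cpk}(\pi)}t^{\mathrm{cval}(\pi)}u^{\mathrm{cdasc}(\pi)}v^{\mathrm{cddes}(\pi)}\Bigr)\frac{x^n}{n!}=\frac{1}{1-st\,V\!\left(st,\tfrac{u+v}{2};x\right)}.$$ -/

import Mathlib

namespace CyclicStat

/-- Number of cyclic peaks: letters `π i` with `i < π i > π (π i)`. The letters `π i` are counted
through their positions `i`. -/
def cpk {n : ℕ} (π : Equiv.Perm (Fin n)) : ℕ :=
  (Finset.univ.filter fun i : Fin n => i < π i ∧ π (π i) < π i).card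

/-- Number of cyclic valleys: letters `π i` with `i > π i < π (π i)`. -/
def cval {n : ℕ} (π : Equiv.Perm (Fin n)) : ℕ :=
  (Finset.univ.filter fun i : Fin n => π i < i ∧ π i < π (π i)).card

/-- Number of cyclic double ascents: letters `π i` with `i < π i < π (π i)`. -/
def cdasc {n : ℕ} (π : Equiv.Perm (Fin n)) : ℕ :=
  (Finset.univ.filter fun i : Fin n => i < π i ∧ π i < π (π i)).card

/-- Number of cyclic double descents: letters `π i` with `i > π i > π (π i)`. -/
def cddes {n : ℕ} (π : Equiv.Perm (Fin n)) : ℕ :=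
  (Finset.univ.filter fun i : Fin n => π i < i ∧ π (π i) < π i).card

/-- The polynomial `D_n(s,t,u,v)`, the sum over all derangements `π` of `n` ordered letters of
`s ^ cpk π * t ^ cval π * u ^ cdasc π * v ^ cddes π`. -/
def derangementPoly {R : Type*} [CommRing R] (n : ℕ) (s t u v : R) : R :=
  ∑ π : Equiv.Perm (Fin n) with π ∈ derangements (Fin n),
    s ^ cpk π * t ^ cval π * u ^ cdasc π * v ^ cddes π

/-- The formal power series `D(s,t,u,v;x) = 1 + ∑_{n ≥ 1} D_n(s,t,u,v) x^n / n!` in `x`. -/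
noncomputable def derangementEGF {R : Type*} [CommRing R] [Algebra ℚ R] (s t u v : R) :
    PowerSeries R :=
  PowerSeries.mk fun n =>
    if n = 0 then 1 else (1 / (n.factorial : ℚ)) • derangementPoly n s t u v

/-- The bivariate Chebyshev polynomials of the second kind `U_n(s,t)`. -/
def chebU {R : Type*} [CommRing R] (s t : R) : ℕ → R
  | 0 => 1
  | 1 => 2 * t
  | n + 2 => 2 * t * chebU s t (n + 1) - s * chebU s t n

/-- The formal power series `V(s,t;x) = ∑_{n ≥ 0} U_n(s,t) x^(n+2) / (n+2)!` in `x`. -/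
noncomputable def chebV {R : Type*} [CommRing R] [Algebra ℚ R] (s t : R) : PowerSeries R :=
  PowerSeries.mk fun m =>
    match m with
    | 0 => 0
    | 1 => 0
    | n + 2 => (1 / ((n + 2).factorial : ℚ)) • chebU s t n

end CyclicStat

namespace CyclicStat

/-! ### Chebyshev polynomials under a derivation, and the binomial convolution -/

section Algebra

variable {A : Type*} [CommRing A]

/-! Give fixed points a weight `z`. Inserting a new minimum into a permutation either creates a
fixed point or splits an arc of a cycle. Summed over all arcs, the second case acts on weights as
the derivation `D` with `s ↦ 0`, `t ↦ t(u+v)` and `u, v, z ↦ st`, so the permutation polynomials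
satisfy `P (n+1) = z P n + D (P n)` (`permPoly_succ`). For `c = st` and `q = (u+v)/2` one has `D c =
2qc` and `D q = c`, which makes `D` act simply on the denominator coefficients
(`derivation_denomCoeff`). Hence their binomial convolution with `P` is `z ^ n`; setting `z = 0`
leaves the derangements and turns `z ^ n` into the coefficients of `1`. -/

theorem chebU_succ_succ (s t : A) (n : ℕ) :
    chebU s t (n + 2) = 2 * t * chebU s t (n + 1) - s * chebU s t n := by
  rw [chebU]

theorem map_chebU {B : Type*} [CommRing B] (f : A →+* B) (s t : A) (n : ℕ) :
    f (chebU s t n) = chebU (f s) (f t) n := by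
  induction n using Nat.twoStepInduction with
  | zero => simp [chebU]
  | one => simp [chebU, map_ofNat f 2]
  | more n h0 h1 => simp [chebU_succ_succ, h0, h1, map_ofNat f 2]

theorem derivation_chebU_succ [Algebra ℚ A] (D : Derivation ℚ A A) {c q : A} (hc : D c = c * (2 * q))
    (hq : D q = c) (n : ℕ) :
    D (chebU c q (n + 1)) = (n + 2) * c * chebU c q n := by
  have h2 : D (2 : A) = 0 := by simpa using D.map_natCast 2
  induction n using Nat.twoStepInduction with
  | zero => simp [chebU, hq, h2]
  | one => simp [chebU, hq, hc, h2]; ring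
  | more n h0 h1 =>
    rw [chebU_succ_succ, chebU_succ_succ c q n] at *
    simp only [map_sub, Derivation.leibniz, smul_eq_mul, hq, hc, h0, h1, h2]
    push_cast
    ring

/-- The coefficients of `1 - c V(c, q; x)` with respect to `x ^ n / n!`. -/
def denomCoeff (c q : A) : ℕ → A
  | 0 => 1
  | 1 => 0
  | n + 2 => -(c * chebU c q n)

theorem map_denomCoeff {B : Type*} [CommRing B] (f : A →+* B) (c q : A) (n : ℕ) :
    f (denomCoeff c q n) = denomCoeff (f c) (f q) n := by
  match n with
  | 0 => simp [denomCoeff]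
  | 1 => simp [denomCoeff]
  | n + 2 => simp [denomCoeff, map_chebU]

theorem derivation_denomCoeff [Algebra ℚ A] (D : Derivation ℚ A A) {c q : A} (hc : D c = c * (2 * q))
    (hq : D q = c) (n : ℕ) :
    D (denomCoeff c q n) = denomCoeff c q (n + 1) + n * c * denomCoeff c q (n - 1) := by
  match n with
  | 0 => simp [denomCoeff]
  | 1 => simp [denomCoeff, chebU]
  | 2 => simp [denomCoeff, chebU, hc]
  | n + 3 =>
    simp only [denomCoeff, map_neg, Derivation.leibniz, derivation_chebU_succ D hc hq, hc,
      smul_eq_mul, chebU_succ_succ, show n + 3 - 1 = n + 2 from rfl]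
    push_cast
    ring

open Finset in
theorem sum_choose_mul_snd_mul (f : ℕ → ℕ → A) (n : ℕ) :
    ∑ ij ∈ antidiagonal n, (n.choose ij.1 : A) * (ij.2 * f ij.1 (ij.2 - 1)) =
      n * ∑ ij ∈ antidiagonal (n - 1), ((n - 1).choose ij.1 : A) * f ij.1 ij.2 := by
  cases n with
  | zero => simp
  | succ n =>
    rw [Nat.sum_antidiagonal_succ']
    simp only [Nat.cast_zero, zero_mul, mul_zero, zero_add, Nat.add_sub_cancel, mul_sum]
    refine sum_congr rfl fun ij hij => ?_
    have h : (n + 1).choose ij.1 * (ij.2 + 1) = (n + 1) * n.choose ij.1 := by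
      obtain ⟨i, j⟩ := ij
      obtain rfl : i + j = n := by simpa using hij
      have := Nat.choose_mul_succ_eq (i + j) i
      rw [show i + j + 1 - i = j + 1 by omega] at this
      simp only
      linarith
    have h' : ((n + 1).choose ij.1 : A) * (ij.2 + 1) = (n + 1) * n.choose ij.1 := by
      exact_mod_cast congrArg (Nat.cast : ℕ → A) h
    push_cast
    linear_combination f ij.1 ij.2 * h'

open Finset in
/-- Binomial convolution solves the recurrence `P (n + 1) = z P n + D (P n)`. -/
theorem sum_choose_mul_denomCoeff [Algebra ℚ A] (D : Derivation ℚ A A) {c q z : A} (hc : D c = c * (2 * q))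
    (hq : D q = c) (hz : D z = c) (P : ℕ → A) (h0 : P 0 = 1)
    (hP : ∀ n, P (n + 1) = z * P n + D (P n)) (n : ℕ) :
    ∑ ij ∈ antidiagonal n, (n.choose ij.1 : A) * (P ij.1 * denomCoeff c q ij.2) = z ^ n := by
  induction n using Nat.strong_induction_on with
  | _ n ih =>
  cases n with
  | zero => simp [h0, denomCoeff]
  | succ n =>
    have key := congrArg D (ih n n.lt_succ_self)
    have hstep : ∀ ij ∈ antidiagonal n,
        D ((n.choose ij.1 : A) * (P ij.1 * denomCoeff c q ij.2)) =
          (n.choose ij.1 : A) * (P ij.1 * denomCoeff c q (ij.2 + 1)) +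
          (n.choose ij.2 : A) * (P (ij.1 + 1) * denomCoeff c q ij.2) +
          c * ((n.choose ij.1 : A) * (ij.2 * (P ij.1 * denomCoeff c q (ij.2 - 1)))) -
          z * ((n.choose ij.1 : A) * (P ij.1 * denomCoeff c q ij.2)) := by
      intro ij hij
      have hs : n.choose ij.2 = n.choose ij.1 := by
        rw [HasAntidiagonal.mem_antidiagonal] at hij
        exact Nat.choose_symm_of_eq_add (by omega)
      simp only [Derivation.leibniz, Derivation.map_natCast, smul_eq_mul,
        derivation_denomCoeff D hc hq, hP, hs]
      ring
    -- With `S n` the convolution, this reads `D (S n) = S (n+1) + n c S (n-1) - z S n`. The term `n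
    -- c z^(n-1)` cancels against `D (z^n)`; at `n = 0` the factor `n` makes the truncated `n - 1`
    -- harmless.
    rw [map_sum, sum_congr rfl hstep, sum_sub_distrib, sum_add_distrib, sum_add_distrib,
      ← Finset.sum_antidiagonal_choose_succ_mul (fun i j => P i * denomCoeff c q j),
      ← mul_sum, ← mul_sum, ih n n.lt_succ_self,
      sum_choose_mul_snd_mul (fun i j => P i * denomCoeff c q j), ih (n - 1) (by omega),
      Derivation.leibniz_pow, hz] at key
    simp only [smul_eq_mul, nsmul_eq_mul] at key
    linear_combination key

end Algebra

/-! ### Inserting a new minimum into a cycle -/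

section Insertion

variable {A : Type*} [CommRing A]

/-- The weight of the letter `j` with predecessor `a` and successor `b` in its cycle:
`s`, `t`, `u`, `v`, `z` for a peak, valley, double ascent, double descent, fixed point. -/
def letterWeight {α : Type*} [LinearOrder α] (s t u v z : A) (a j b : α) : A :=
  if a < j then (if j < b then u else s)
  else if j < a then (if j < b then t else v) else z

/-- The product of the weights of all letters of `π`. -/
def permWeight {n : ℕ} (s t u v z : A) (π : Equiv.Perm (Fin n)) : A :=
  ∏ j, letterWeight s t u v z (π.symm j) j (π j)

variable {n : ℕ} (s t u v z : A) (e : Equiv.Perm (Fin n))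

open Equiv.Perm

theorem decomposeFin_symm_symm_zero (p : Fin n) :
    (decomposeFin.symm (p.succ, e)).symm 0 = (e.symm p).succ := by
  rw [Equiv.symm_apply_eq]
  simp

theorem decomposeFin_symm_symm_succ_self (p : Fin n) :
    (decomposeFin.symm (p.succ, e)).symm p.succ = 0 := by
  rw [Equiv.symm_apply_eq]
  simp

theorem decomposeFin_symm_symm_succ_of_ne {p j : Fin n} (h : j ≠ p) :
    (decomposeFin.symm (p.succ, e)).symm j.succ = (e.symm j).succ := by
  rw [Equiv.symm_apply_eq]
  simp [Equiv.swap_apply_of_ne_of_ne, h]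

theorem decomposeFin_symm_apply_succ_of_ne {p j : Fin n} (h : e j ≠ p) :
    decomposeFin.symm (p.succ, e) j.succ = (e j).succ := by
  simp [Equiv.swap_apply_of_ne_of_ne, h]

theorem permWeight_decomposeFin_symm_zero :
    permWeight s t u v z (decomposeFin.symm (0, e)) = z * permWeight s t u v z e := by
  have h (j : Fin n) : (decomposeFin.symm ((0 : Fin (n + 1)), e)).symm j.succ = (e.symm j).succ := by
    rw [Equiv.symm_apply_eq]
    simp
  have h0 : (decomposeFin.symm ((0 : Fin (n + 1)), e)).symm 0 = 0 := by
    rw [Equiv.symm_apply_eq]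
    simp
  simp [permWeight, Fin.prod_univ_succ, letterWeight, h, h0]

/-- Inserting a new minimum before `p` only changes the weight of one letter `k`. -/
theorem permWeight_insert_eq {p k : Fin n} {x : A}
    (hk : letterWeight s t u v z ((decomposeFin.symm (p.succ, e)).symm k.succ) k.succ
      (decomposeFin.symm (p.succ, e) k.succ) = x)
    (hne : ∀ j ≠ k, letterWeight s t u v z ((decomposeFin.symm (p.succ, e)).symm j.succ) j.succ
      (decomposeFin.symm (p.succ, e) j.succ) = letterWeight s t u v z (e.symm j) j (e j)) :
    permWeight s t u v z (decomposeFin.symm (p.succ, e)) =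
      (∏ j ∈ Finset.univ.erase k, letterWeight s t u v z (e.symm j) j (e j)) * (t * x) := by
  rw [permWeight, Fin.prod_univ_succ, ← Finset.mul_prod_erase _ _ (Finset.mem_univ k), hk,
    Finset.prod_congr rfl fun j hj => hne j (Finset.ne_of_mem_erase hj),
    decomposeFin_symm_symm_zero]
  simp [letterWeight]
  ring

/-- On a descending arc, the tail keeps a smaller successor, so only the head `p` changes type. -/
theorem permWeight_insert_of_lt {p : Fin n} (h : p < e.symm p) :
    permWeight s t u v z (decomposeFin.symm (p.succ, e)) =
      (∏ j ∈ Finset.univ.erase p, letterWeight s t u v z (e.symm j) j (e j)) *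
        (t * if p < e p then u else s) := by
  have hp : e p ≠ p := fun hp => h.ne (by rw [Equiv.eq_symm_apply, hp])
  refine permWeight_insert_eq s t u v z e ?_ fun j hj => ?_
  · rw [decomposeFin_symm_symm_succ_self, decomposeFin_symm_apply_succ_of_ne e hp]
    simp [letterWeight]
  · rw [decomposeFin_symm_symm_succ_of_ne e hj]
    by_cases hjp : e j = p
    · obtain rfl : j = e.symm p := by rw [Equiv.eq_symm_apply, hjp]
      simp [letterWeight, h.not_gt]
    · rw [decomposeFin_symm_apply_succ_of_ne e hjp]
      simp [letterWeight]

/-- On an ascending arc, the head keeps a smaller predecessor, so only the tail `k` changes type. -/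
theorem permWeight_insert_apply_of_lt {k : Fin n} (h : k < e k) :
    permWeight s t u v z (decomposeFin.symm ((e k).succ, e)) =
      (∏ j ∈ Finset.univ.erase k, letterWeight s t u v z (e.symm j) j (e j)) *
        (t * if e.symm k < k then s else v) := by
  refine permWeight_insert_eq s t u v z e ?_ fun j hj => ?_
  · rw [decomposeFin_symm_symm_succ_of_ne e h.ne]
    have hk : e.symm k ≠ k := fun hk => h.ne (by rw [Equiv.symm_apply_eq] at hk; exact hk)
    rcases hk.lt_or_gt with h1 | h1
    · simp [letterWeight, h1]
    · simp [letterWeight, h1, h1.not_gt]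
  · rw [decomposeFin_symm_apply_succ_of_ne e (e.injective.ne hj)]
    by_cases hjp : j = e k
    · subst hjp
      rw [decomposeFin_symm_symm_succ_self]
      simp [letterWeight, h]
    · rw [decomposeFin_symm_symm_succ_of_ne e hjp]
      simp [letterWeight]

theorem permWeight_insert_of_eq {p : Fin n} (h : e p = p) :
    permWeight s t u v z (decomposeFin.symm (p.succ, e)) =
      (∏ j ∈ Finset.univ.erase p, letterWeight s t u v z (e.symm j) j (e j)) * (t * s) := by
  refine permWeight_insert_eq s t u v z e ?_ fun j hj => ?_
  · rw [decomposeFin_symm_symm_succ_self]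
    simp [letterWeight, h]
  · rw [decomposeFin_symm_symm_succ_of_ne e hj,
      decomposeFin_symm_apply_succ_of_ne e fun h' => hj (e.injective (h'.trans h.symm))]
    simp [letterWeight]

theorem sum_permWeight_insert_eq :
    ∑ p : Fin n, permWeight s t u v z (decomposeFin.symm (p.succ, e)) =
      ∑ k : Fin n, (∏ j ∈ Finset.univ.erase k, letterWeight s t u v z (e.symm j) j (e j)) *
        letterWeight 0 (t * (u + v)) (s * t) (s * t) (s * t) (e.symm k) k (e k) := by
  -- Charge each arc to the letter whose type changes: descending arcs and loops to the head,
  -- ascending arcs to the tail, hence the reindexing by `e`. A valley is charged twice (giving `u`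
  -- and `v`), a peak never.
  have hsplit (p : Fin n) : permWeight s t u v z (decomposeFin.symm (p.succ, e)) =
      (if p ≤ e.symm p then permWeight s t u v z (decomposeFin.symm (p.succ, e)) else 0) +
      (if e.symm p < p then permWeight s t u v z (decomposeFin.symm (p.succ, e)) else 0) := by
    rcases lt_or_ge (e.symm p) p with h | h
    · simp [h, h.not_ge]
    · simp [h, h.not_gt]
  rw [Finset.sum_congr rfl fun p _ => hsplit p, Finset.sum_add_distrib,
    ← Equiv.sum_comp e fun p =>
      if e.symm p < p then permWeight s t u v z (decomposeFin.symm (p.succ, e)) else 0,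
    ← Finset.sum_add_distrib]
  refine Finset.sum_congr rfl fun k _ => ?_
  rw [Equiv.symm_apply_apply]
  rcases lt_trichotomy (e.symm k) k with h1 | h1 | h1
  · by_cases h2 : k < e k
    · simp [h1, h1.not_ge, h2, permWeight_insert_apply_of_lt s t u v z e h2, letterWeight,
        mul_comm t s]
    · simp [h1, h1.not_ge, h2, letterWeight]
  · have h2 : e k = k := by rw [Equiv.symm_apply_eq] at h1; exact h1.symm
    simp [h1, h2, permWeight_insert_of_eq s t u v z e h2, letterWeight, mul_comm t s]
  · by_cases h2 : k < e k
    · simp [h1.le, h1, h1.not_gt, h2, permWeight_insert_apply_of_lt s t u v z e h2,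
        permWeight_insert_of_lt s t u v z e h1, letterWeight]
      ring
    · simp [h1.le, h1, h1.not_gt, h2, permWeight_insert_of_lt s t u v z e h1, letterWeight,
        mul_comm t s]

theorem derivation_prod [Algebra ℚ A] (D : Derivation ℚ A A) {ι : Type*} [DecidableEq ι]
    (S : Finset ι) (f : ι → A) :
    D (∏ i ∈ S, f i) = ∑ i ∈ S, (∏ j ∈ S.erase i, f j) * D (f i) := by
  induction S using Finset.induction_on with
  | empty => simp
  | insert a S ha ih =>
    rw [Finset.prod_insert ha, Derivation.leibniz, ih, Finset.sum_insert ha,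
      Finset.erase_insert ha, add_comm, smul_eq_mul, smul_eq_mul, Finset.mul_sum]
    refine congrArg _ (Finset.sum_congr rfl fun i hi => ?_)
    have hai : a ≠ i := fun h => ha (h ▸ hi)
    rw [Finset.erase_insert_of_ne hai,
      Finset.prod_insert fun h => ha (Finset.mem_of_mem_erase h), mul_assoc]

/-- The generating polynomial of all permutations of `n` letters by the types of their letters. -/
def permPoly (s t u v z : A) (n : ℕ) : A :=
  ∑ π : Equiv.Perm (Fin n), permWeight s t u v z π

theorem permPoly_zero : permPoly s t u v z 0 = 1 := by
  simp [permPoly, permWeight]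

theorem permPoly_succ [Algebra ℚ A] (D : Derivation ℚ A A) (hs : D s = 0)
    (ht : D t = t * (u + v)) (hu : D u = s * t) (hv : D v = s * t) (hz : D z = s * t) (n : ℕ) :
    permPoly s t u v z (n + 1) = z * permPoly s t u v z n + D (permPoly s t u v z n) := by
  have hD {n : ℕ} (a j b : Fin n) : D (letterWeight s t u v z a j b) =
      letterWeight 0 (t * (u + v)) (s * t) (s * t) (s * t) a j b := by
    unfold letterWeight
    split_ifs <;> assumption
  rw [permPoly, ← Equiv.sum_comp decomposeFin.symm, Fintype.sum_prod_type, Fin.sum_univ_succ,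
    Finset.sum_comm]
  congr 1
  · simp_rw [permWeight_decomposeFin_symm_zero, permPoly, Finset.mul_sum]
  · rw [permPoly, map_sum]
    refine Finset.sum_congr rfl fun e _ => ?_
    rw [sum_permWeight_insert_eq, permWeight, derivation_prod]
    simp [hD]

theorem map_permPoly {B : Type*} [CommRing B] (f : A →+* B) (n : ℕ) :
    f (permPoly s t u v z n) = permPoly (f s) (f t) (f u) (f v) (f z) n := by
  simp only [permPoly, permWeight, letterWeight, map_sum, map_prod, apply_ite f]

theorem permWeight_zero_of_mem_derangements {π : Equiv.Perm (Fin n)}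
    (h : π ∈ derangements (Fin n)) :
    permWeight s t u v 0 π = s ^ cpk π * t ^ cval π * u ^ cdasc π * v ^ cddes π := by
  rw [permWeight, ← Equiv.prod_comp π]
  simp only [cpk, cval, cdasc, cddes, Finset.card_filter, ← Finset.prod_pow_eq_pow_sum,
    ← Finset.prod_mul_distrib]
  refine Finset.prod_congr rfl fun i _ => ?_
  have h1 : π i ≠ i := h i
  have h2 : π (π i) ≠ π i := h (π i)
  rw [Equiv.symm_apply_apply, letterWeight]
  rcases h1.lt_or_gt with h1 | h1 <;> rcases h2.lt_or_gt with h2 | h2 <;>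
    simp [h1, h2, h1.not_gt, h2.not_gt]

theorem permPoly_fixed_zero (n : ℕ) : permPoly s t u v 0 n = derangementPoly n s t u v := by
  classical
  rw [permPoly, derangementPoly, Finset.sum_filter]
  refine Finset.sum_congr rfl fun π _ => ?_
  split_ifs with h
  · exact permWeight_zero_of_mem_derangements s t u v h
  · obtain ⟨j, hj⟩ : ∃ j, π j = j := by simpa [derangements] using h
    refine Finset.prod_eq_zero (Finset.mem_univ j) ?_
    have hj' : π.symm j = j := by rw [Equiv.symm_apply_eq, hj]
    simp [letterWeight, hj']

end Insertion

/-! ### Specialisation and generating functions -/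

section Main

variable {R : Type*} [CommRing R] [Algebra ℚ R]

open MvPolynomial in
theorem sum_choose_mul_derangementPoly (s t u v : R) (n : ℕ) :
    ∑ ij ∈ Finset.HasAntidiagonal.antidiagonal n, (n.choose ij.1 : R) * (derangementPoly ij.1 s t u v *
      denomCoeff (s * t) ((1 / 2 : ℚ) • (u + v)) ij.2) = 0 ^ n := by
  -- `D` need not exist on `R`, and `z = 0` is incompatible with `D z = st` unless `st = 0`; so the
  -- identity is proved for indeterminates and then specialised.
  let S : MvPolynomial (Fin 5) ℚ := X 0
  let T : MvPolynomial (Fin 5) ℚ := X 1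
  let U : MvPolynomial (Fin 5) ℚ := X 2
  let V : MvPolynomial (Fin 5) ℚ := X 3
  let Z : MvPolynomial (Fin 5) ℚ := X 4
  let D : Derivation ℚ (MvPolynomial (Fin 5) ℚ) (MvPolynomial (Fin 5) ℚ) :=
    mkDerivation ℚ ![0, T * (U + V), S * T, S * T, S * T]
  have hS : D S = 0 := by simp [D, S, mkDerivation_X]
  have hT : D T = T * (U + V) := by simp [D, T, mkDerivation_X]
  have hU : D U = S * T := by simp [D, U, mkDerivation_X]
  have hV : D V = S * T := by simp [D, V, mkDerivation_X]
  have hZ : D Z = S * T := by simp [D, Z, mkDerivation_X]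
  have htwo : 2 * ((1 / 2 : ℚ) • (U + V)) = U + V := by
    rw [two_mul, ← add_smul]
    norm_num
  have hq : D ((1 / 2 : ℚ) • (U + V)) = S * T := by
    rw [Derivation.map_smul, map_add, hU, hV, ← two_smul ℚ (S * T), smul_smul]
    norm_num
  have hc : D (S * T) = S * T * (2 * ((1 / 2 : ℚ) • (U + V))) := by
    rw [htwo, Derivation.leibniz, hS, hT]
    simp only [smul_eq_mul]
    ring
  let φ : MvPolynomial (Fin 5) ℚ →+* R := eval₂Hom (algebraMap ℚ R) ![s, t, u, v, 0]
  have key := congrArg φ <|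
    sum_choose_mul_denomCoeff D hc hq hZ (permPoly S T U V Z) (permPoly_zero ..)
      (permPoly_succ S T U V Z D hS hT hU hV hZ) n
  have φS : φ S = s := by simp [φ, S]
  have φT : φ T = t := by simp [φ, T]
  have φU : φ U = u := by simp [φ, U]
  have φV : φ V = v := by simp [φ, V]
  have φZ : φ Z = 0 := by simp [φ, Z]
  have φq : φ ((1 / 2 : ℚ) • (U + V)) = (1 / 2 : ℚ) • (u + v) := by
    rw [map_rat_smul φ, map_add, φU, φV]
  simpa only [map_sum, map_mul, map_pow, map_natCast, map_permPoly, map_denomCoeff, φS, φT, φU,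
    φV, φZ, φq, permPoly_fixed_zero] using key

theorem coeff_one_sub_chebV (c q : R) (n : ℕ) :
    PowerSeries.coeff n (1 - PowerSeries.C c * chebV c q) =
      (1 / (n.factorial : ℚ)) • denomCoeff c q n := by
  match n with
  | 0 => simp [chebV, denomCoeff]
  | 1 => simp [chebV, denomCoeff, PowerSeries.coeff_one]
  | n + 2 => simp [chebV, denomCoeff, PowerSeries.coeff_one]

theorem derangementEGF_mul (s t u v : R) :
    derangementEGF s t u v *
      (1 - PowerSeries.C (s * t) * chebV (s * t) ((1 / 2 : ℚ) • (u + v))) = 1 := by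
  have hD (n : ℕ) : PowerSeries.coeff n (derangementEGF s t u v) =
      (1 / (n.factorial : ℚ)) • derangementPoly n s t u v := by
    rw [derangementEGF, PowerSeries.coeff_mk]
    split_ifs with h
    · subst h
      simp [← permPoly_fixed_zero, permPoly_zero]
    · rfl
  ext n
  have key := congrArg ((1 / (n.factorial : ℚ)) • ·) (sum_choose_mul_derangementPoly s t u v n)
  rw [PowerSeries.coeff_mul, PowerSeries.coeff_one]
  convert key using 1
  · simp only [Finset.smul_sum]
    refine Finset.sum_congr rfl fun ij hij => ?_
    obtain ⟨i, j⟩ := ij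
    obtain rfl : i + j = n := by simpa using hij
    dsimp only
    rw [hD, coeff_one_sub_chebV, smul_mul_smul_comm, ← nsmul_eq_mul, ← Nat.cast_smul_eq_nsmul ℚ,
      smul_smul, Nat.choose_symm_add, Nat.add_choose, Nat.cast_div (Nat.factorial_mul_factorial_dvd_factorial_add i j)]
    · congr 1
      have := (i + j).factorial_ne_zero
      push_cast
      field_simp
    · exact_mod_cast (Nat.mul_pos i.factorial_pos j.factorial_pos).ne'
  · cases n <;> simp

end Main

end CyclicStat

theorem theorem8 {R : Type*} [CommRing R] [Algebra ℚ R] (s t u v : R) :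
    IsUnit (1 - PowerSeries.C (s * t) * CyclicStat.chebV (s * t) ((1 / 2 : ℚ) • (u + v))) ∧
      CyclicStat.derangementEGF s t u v =
        Ring.inverse
          (1 - PowerSeries.C (s * t) * CyclicStat.chebV (s * t) ((1 / 2 : ℚ) • (u + v))) := by
  have h := CyclicStat.derangementEGF_mul s t u v
  have hu : IsUnit (1 - PowerSeries.C (s * t) *
      CyclicStat.chebV (s * t) ((1 / 2 : ℚ) • (u + v))) := IsUnit.of_mul_eq_one_right _ h
  exact ⟨hu, hu.mul_right_cancel (by rw [h, Ring.inverse_mul_cancel _ hu])⟩
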